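/- **Setting.** Let $\Omega_x=(l,r)$ be a bounded open interval, $T>0$, $a\in C^\infty(\overline{\Omega}_x)$ real-valued with $a\ge\alpha_0>0$, and consider the backward problem $$\partial_t u=\partial_x(a(x)\partial_x u)\quad (0<t<T,\ x\in\Omega_x),\qquad u=0\ \text{on }\partial\Omega_x,\qquad u(T,\cdot)=u_T .$$ Let $\lambda_1\le\lambda_2\le\cdots$ be the Dirichlet eigenvalues of $\mathcal L=-\partial_x(a\,\partial_x\,\cdot\,)$ on $\Omega_x$ and $\phi_k$ ($k\ge1$) corresponding real eigenfunctions, $\mathcal L\phi_k=\lambda_k\phi_k$, $\phi_k|_{\partial\Omega_x}=0$, orthonormal in $L^2(\Omega_x)$. Let $s\ge0$. For real-valued $v\in L^2(\Omega_x)$ put $$\|v\|_{H^s}^2=\sum_{k\ge1}\Big|\int_{\Omega_x}v\,\phi_k\,dx\Big|^2\big(1+\lambda_k+\cdots+\lambda_k^s\big)$$ (for non-integer $s$ the weight is $1+\lambda_k+\cdots+\lambda_k^{\lfloor s\rfloor}+\lambda_k^s$), and write $v\in H^s$ if this is finite. For data $u_T$ let $$\alpha_k(T)=\int_{\Omega_x}u_T\,\phi_k\,dx,\qquad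 \alpha_k(t)=e^{\lambda_k(T-t)}\alpha_k(T),$$ and say that $u$ is given by the expansion if $u(t,\cdot)=\sum_{k\ge1}\alpha_k(t)\phi_k$ with convergence in $L^2(\Omega_x)$ for all $t\in[0,T]$, and $u(T,\cdot)=u_T$. For $n\ge1$ let $$w_n(t,x,p)=\sum_{1\le k\le n}e^{-|p-\lambda_k(T-t)|}\alpha_k(T)\phi_k(x),\qquad \delta(n)=\Big(\sum_{k\ge n}|\alpha_k(0)|^2\lambda_k^s\Big)^{1/2}\in[0,\infty].$$ **Theorem.** 1. Suppose that $u_T\in H^s$ is a finite linear combination of its expansion terms, i.e. $u_T=\sum_{k\le N}\alpha_k(T)\phi_k$ a.e. for some $N$, or that $u_T$ is the truncation $\sum_{k\le N}\big(\int_{\Omega_x} g\,\phi_k\,dx\big)\phi_k$ of some $g\in H^s$. Then there is a function $u$ which is given by the expansion, is a classical solution of the backward problem (with $u(T,\cdot)=u_T$ a.e.), and satisfies $u(t,\cdot)\in H^s$ for all $t\in[0,T]$. 2. Let $u_T\in H^s$ and let $u$ be given by the expansion (in particular, $u$ may be the solution in part 1). Let $\varepsilon>0$, and let $n_{\max}\ge1$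 be such that $\delta(n_{\max})/\lambda_{n_{\max}}^{s/2}\le\varepsilon$. Let $p>\lambda_{n_{\max}}T$ and let $u_{n_{\max}}$ be recovered by either of $$u_{n_{\max}}(t,x)=e^{p}\,w_{n_{\max}}(t,x,p)\qquad\text{or}\qquad u_{n_{\max}}(t,x)=e^{p}\int_p^\infty w_{n_{\max}}(t,x,q)\,dq .$$ Then for all $t\in[0,T]$ $$\|u(t,\cdot)-u_{n_{\max}}(t,\cdot)\|_{L^2(\Omega_x)}\le e^{-\lambda_{n_{\max}}t}\,\frac{\delta(n_{\max})}{\lambda_{n_{\max}}^{s/2}}\le\varepsilon .$$ -/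

import Mathlib

open Set Filter Topology MeasureTheory
open scoped ENNReal ContDiff

noncomputable section

namespace BackwardHeat

/-- `ψ` is a (classical) Dirichlet eigenfunction of `-(a ψ')'` on `(l, r)` with eigenvalue `μ`. -/
structure IsDirichletEigenpair (l r : ℝ) (a : ℝ → ℝ) (μ : ℝ) (ψ : ℝ → ℝ) : Prop where
  contDiffOn : ContDiffOn ℝ 2 ψ (Icc l r)
  eigen : ∀ x ∈ Ioo l r, -deriv (fun y => a y * deriv ψ y) x = μ * ψ x
  left : ψ l = 0
  right : ψ r = 0
  ne_zero : ∃ x ∈ Icc l r, ψ x ≠ 0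

/-- `ev 1 ≤ ev 2 ≤ …` lists all the Dirichlet eigenvalues of `-(a ψ')'` on `(l, r)`, and `φ k` is
a `k`-th eigenfunction, the `φ k` being chosen orthonormal in `L²(l, r)`.  In one space dimension
eigenvalues are simple, so listing every eigenvalue is the same as listing every eigenfunction
up to a scalar. Positivity of the eigenvalues and completeness of the system are not part of the
definition. -/
structure IsDirichletEigensystem (l r : ℝ) (a : ℝ → ℝ) (ev : ℕ+ → ℝ) (φ : ℕ+ → ℝ → ℝ) :
    Prop where
  eigenpair : ∀ k, IsDirichletEigenpair l r a (ev k) (φ k)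
  monotone : Monotone ev
  orthonormal : ∀ j k, ∫ x in Ioo l r, φ j x * φ k x = if j = k then 1 else 0
  exhaustive : ∀ μ ψ, IsDirichletEigenpair l r a μ ψ → ∃ k, ev k = μ

/-- The `k`-th coefficient `∫ f φ_k` of `f`. -/
def coeff (l r : ℝ) (φ : ℕ+ → ℝ → ℝ) (f : ℝ → ℝ) (k : ℕ+) : ℝ :=
  ∫ x in Ioo l r, f x * φ k x

/-- The weight `1 + λ + ⋯ + λ ^ s`; for non-integer `s` it is `1 + λ + ⋯ + λ ^ ⌊s⌋ + λ ^ s`. -/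
def hsWeight (s μ : ℝ) : ℝ :=
  (∑ j ∈ Finset.range ⌈s⌉₊, μ ^ j) + μ ^ s

/-- `f ∈ H^s`, where `‖f‖²_{H^s} = ∑ |∫ f φ_k|² (1 + λ_k + ⋯ + λ_k ^ s)`. -/
def MemHs (l r : ℝ) (ev : ℕ+ → ℝ) (φ : ℕ+ → ℝ → ℝ) (s : ℝ) (f : ℝ → ℝ) : Prop :=
  MemLp f 2 (volume.restrict (Ioo l r)) ∧
    Summable fun k => |coeff l r φ f k| ^ 2 * hsWeight s (ev k)

/-- The truncation of the eigenfunction expansion of `f` to its first `N` terms. -/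
def truncate (l r : ℝ) (φ : ℕ+ → ℝ → ℝ) (N : ℕ+) (f : ℝ → ℝ) (x : ℝ) : ℝ :=
  ∑ k ∈ Finset.Icc 1 N, coeff l r φ f k * φ k x

/-- `f` is (almost everywhere) equal to a finite partial sum of its eigenfunction expansion. -/
def HasFiniteExpansion (l r : ℝ) (φ : ℕ+ → ℝ → ℝ) (f : ℝ → ℝ) : Prop :=
  ∃ N : ℕ+, f =ᵐ[volume.restrict (Ioo l r)] truncate l r φ N f

/-- `α_k(t) = e^{λ_k (T - t)} α_k(T)`, where `α_k(T) = ∫ u_T φ_k`. -/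
def alpha (l r : ℝ) (ev : ℕ+ → ℝ) (φ : ℕ+ → ℝ → ℝ) (T : ℝ) (uT : ℝ → ℝ) (k : ℕ+) (t : ℝ) : ℝ :=
  Real.exp (ev k * (T - t)) * coeff l r φ uT k

/-- `u(t, ·) = ∑_k α_k(t) φ_k` for `0 ≤ t ≤ T`, the series converging in `L²(l, r)`, and
`u(T, ·) = u_T`. -/
structure IsGivenByExpansion (l r : ℝ) (ev : ℕ+ → ℝ) (φ : ℕ+ → ℝ → ℝ) (T : ℝ) (uT : ℝ → ℝ)
    (u : ℝ → ℝ → ℝ) : Prop where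
  memLp : ∀ t ∈ Icc 0 T, MemLp (u t) 2 (volume.restrict (Ioo l r))
  expansion : ∀ t ∈ Icc 0 T, Tendsto
    (fun N : ℕ+ => eLpNorm
      (fun x => u t x - ∑ k ∈ Finset.Icc 1 N, alpha l r ev φ T uT k t * φ k x)
      2 (volume.restrict (Ioo l r))) atTop (𝓝 0)
  terminal : u T =ᵐ[volume.restrict (Ioo l r)] uT

/-- `u` is a classical solution of `∂ₜ u = ∂ₓ (a ∂ₓ u)` on `(0, T) × (l, r)` with homogeneous
Dirichlet conditions at `l` and `r` and final value `u(T, ·) = u_T`. -/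
structure IsClassicalSolution (l r : ℝ) (a : ℝ → ℝ) (T : ℝ) (uT : ℝ → ℝ) (u : ℝ → ℝ → ℝ) :
    Prop where
  continuousOn : ContinuousOn (fun z : ℝ × ℝ => u z.1 z.2) (Icc 0 T ×ˢ Icc l r)
  contDiffOn : ∀ t ∈ Icc 0 T, ContDiffOn ℝ 2 (u t) (Icc l r)
  pde : ∀ t ∈ Ioo 0 T, ∀ x ∈ Ioo l r,
    HasDerivAt (fun τ => u τ x) (deriv (fun y => a y * deriv (u t) y) x) t
  left : ∀ t ∈ Icc 0 T, u t l = 0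
  right : ∀ t ∈ Icc 0 T, u t r = 0
  terminal : u T =ᵐ[volume.restrict (Ioo l r)] uT

/-- `w_n(t, x, p) = ∑_{1 ≤ k ≤ n} e^{-|p - λ_k (T - t)|} α_k(T) φ_k(x)`. -/
def wTrunc (l r : ℝ) (ev : ℕ+ → ℝ) (φ : ℕ+ → ℝ → ℝ) (T : ℝ) (uT : ℝ → ℝ) (n : ℕ+)
    (t x p : ℝ) : ℝ :=
  ∑ k ∈ Finset.Icc 1 n, Real.exp (-|p - ev k * (T - t)|) * coeff l r φ uT k * φ k x

/-- Recovery by point evaluation, `e^p w_n(t, x, p)`. -/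
def recoverPoint (l r : ℝ) (ev : ℕ+ → ℝ) (φ : ℕ+ → ℝ → ℝ) (T : ℝ) (uT : ℝ → ℝ) (n : ℕ+)
    (p t x : ℝ) : ℝ :=
  Real.exp p * wTrunc l r ev φ T uT n t x p

/-- Recovery by integration, `e^p ∫_p^∞ w_n(t, x, q) dq`. -/
def recoverIntegral (l r : ℝ) (ev : ℕ+ → ℝ) (φ : ℕ+ → ℝ → ℝ) (T : ℝ) (uT : ℝ → ℝ) (n : ℕ+)
    (p t x : ℝ) : ℝ :=
  Real.exp p * ∫ q in Ioi p, wTrunc l r ev φ T uT n t x q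

/-- `δ(n) = (∑_{k ≥ n} |α_k(0)|² λ_k ^ s) ^ (1/2)`, with value `∞` if the series diverges. -/
def delta (l r : ℝ) (ev : ℕ+ → ℝ) (φ : ℕ+ → ℝ → ℝ) (T : ℝ) (uT : ℝ → ℝ) (s : ℝ) (n : ℕ+) :
    ℝ≥0∞ :=
  (∑' k : Set.Ici n, ENNReal.ofReal (|alpha l r ev φ T uT k 0| ^ 2 * ev k ^ s)) ^ (1 / 2 : ℝ)

end BackwardHeat

end

/-!
The eigenvalues are positive: for an eigenfunction `ψ` with eigenvalue `μ ≤ 0` the function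
`a ψ' ψ` vanishes at both endpoints and has the nonnegative derivative `a ψ'² - μ ψ²`, so it is
constant, `ψ' = 0` and hence `ψ = 0` (`IsDirichletEigenpair.eigenvalue_pos`).

For data with a finite expansion, orthonormality shows that all later coefficients vanish
(`coeff_eq_zero_of_ae_eq_truncate`), so the solution is a finite sum of the separated solutions
`e^{λ_k (T - t)} φ_k(x)`, for which everything can be checked term by term.

For the error estimate, `p > λ_n T` and `0 < λ_k ≤ λ_n` put `p` to the right of every kink
`λ_k (T - t)` with `k ≤ n`, so both recovery formulas return exactly the `n`-th partial sum of the
expansion. By orthonormality the squared `L²` norm of the remaining terms is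
`∑_{k > n} |α_k(0)|² e^{-2 λ_k t}`, and
`e^{-2 λ_k t} ≤ e^{-2 λ_n t} λ_n^{-s} λ_k^s` for `k > n`
(`eLpNorm_partialSum_sub_le`). Completeness of the eigenfunctions is not needed, since the
convergence of the expansion is part of the assumption on `u`.
-/

namespace BackwardHeat

/-! ### Eigenfunctions -/

section Eigenpair

variable {l r : ℝ} {a : ℝ → ℝ} {μ : ℝ} {ψ : ℝ → ℝ}

theorem IsDirichletEigenpair.differentiableAt (h : IsDirichletEigenpair l r a μ ψ) {x : ℝ}
    (hx : x ∈ Ioo l r) : DifferentiableAt ℝ ψ x :=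
  (h.contDiffOn.contDiffAt (Icc_mem_nhds hx.1 hx.2)).differentiableAt (by norm_num)

theorem IsDirichletEigenpair.differentiableAt_deriv (h : IsDirichletEigenpair l r a μ ψ) {x : ℝ}
    (hx : x ∈ Ioo l r) : DifferentiableAt ℝ (deriv ψ) x := by
  have h1 : ContDiffOn ℝ 1 (deriv ψ) (Ioo l r) :=
    (h.contDiffOn.mono Ioo_subset_Icc_self).deriv_of_isOpen isOpen_Ioo (by norm_num)
  exact (h1.contDiffAt (Ioo_mem_nhds hx.1 hx.2)).differentiableAt (by norm_num)

theorem IsDirichletEigenpair.hasDerivAt_flux (h : IsDirichletEigenpair l r a μ ψ)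
    (ha : ContDiffOn ℝ ∞ a (Icc l r)) {x : ℝ} (hx : x ∈ Ioo l r) :
    HasDerivAt (fun y => a y * deriv ψ y) (-(μ * ψ x)) x := by
  have hax : DifferentiableAt ℝ a x :=
    (ha.contDiffAt (Icc_mem_nhds hx.1 hx.2)).differentiableAt (by simp)
  have hd := (hax.mul (h.differentiableAt_deriv hx)).hasDerivAt
  have he := h.eigen x hx
  have : -(μ * ψ x) = deriv (fun y => a y * deriv ψ y) x := by linarith
  rw [this]
  exact hd

theorem IsDirichletEigenpair.eigenvalue_pos (h : IsDirichletEigenpair l r a μ ψ) (hlr : l < r)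
    {α₀ : ℝ} (hα₀ : 0 < α₀) (ha : ContDiffOn ℝ ∞ a (Icc l r)) (haα : ∀ x ∈ Icc l r, α₀ ≤ a x) :
    0 < μ := by
  by_contra! hμ
  -- One-sided derivatives keep the flux continuous up to the endpoints.
  set g : ℝ → ℝ := fun y => a y * derivWithin ψ (Icc l r) y * ψ y with hg
  have hgc : ContinuousOn g (Icc l r) :=
    (ha.continuousOn.mul (h.contDiffOn.continuousOn_derivWithin (uniqueDiffOn_Icc hlr)
      (by norm_num))).mul h.contDiffOn.continuousOn
  have hgd : ∀ x ∈ Ioo l r, HasDerivAt g (a x * deriv ψ x ^ 2 - μ * ψ x ^ 2) x := by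
    intro x hx
    have h1 := (h.hasDerivAt_flux ha hx).mul (h.differentiableAt hx).hasDerivAt
    have h2 : g =ᶠ[𝓝 x] fun y => a y * deriv ψ y * ψ y := by
      filter_upwards [Ioo_mem_nhds hx.1 hx.2] with y hy
      simp only [hg, derivWithin_of_mem_nhds (Icc_mem_nhds hy.1 hy.2)]
    refine HasDerivAt.congr_of_eventuallyEq ?_ h2
    refine h1.congr_deriv ?_
    ring
  have hpos : ∀ x ∈ Ioo l r, 0 ≤ a x * deriv ψ x ^ 2 := fun x hx =>
    mul_nonneg (hα₀.le.trans (haα x (Ioo_subset_Icc_self hx))) (sq_nonneg _)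
  have hmono : MonotoneOn g (Icc l r) := by
    refine monotoneOn_of_deriv_nonneg (convex_Icc l r) hgc ?_ ?_
    · intro x hx
      rw [interior_Icc] at hx
      exact (hgd x hx).differentiableAt.differentiableWithinAt
    · intro x hx
      rw [interior_Icc] at hx
      rw [(hgd x hx).deriv]
      nlinarith [hpos x hx, mul_nonneg (neg_nonneg.2 hμ) (sq_nonneg (ψ x))]
  have hl : l ∈ Icc l r := left_mem_Icc.2 hlr.le
  have hr : r ∈ Icc l r := right_mem_Icc.2 hlr.le
  have hg0 : ∀ x ∈ Icc l r, g x = 0 := by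
    intro x hx
    have h1 := hmono hl hx hx.1
    have h2 := hmono hx hr hx.2
    simp only [hg, h.left, h.right, mul_zero] at h1 h2
    exact le_antisymm h2 h1
  have hψ' : ∀ x ∈ Ioo l r, deriv ψ x = 0 := by
    intro x hx
    have h1 : g =ᶠ[𝓝 x] fun _ => (0 : ℝ) := by
      filter_upwards [Icc_mem_nhds hx.1 hx.2] with y hy using hg0 y hy
    have h2 : a x * deriv ψ x ^ 2 - μ * ψ x ^ 2 = 0 :=
      (hgd x hx).unique ((hasDerivAt_const x (0 : ℝ)).congr_of_eventuallyEq h1)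
    have h3 : a x * deriv ψ x ^ 2 = 0 := by
      nlinarith [hpos x hx, mul_nonneg (neg_nonneg.2 hμ) (sq_nonneg (ψ x))]
    have h4 : a x ≠ 0 := (hα₀.trans_le (haα x (Ioo_subset_Icc_self hx))).ne'
    simpa [h4] using h3
  obtain ⟨x, hx, hne⟩ := h.ne_zero
  apply hne
  rw [← h.left]
  rcases hx.1.eq_or_lt with rfl | hlx
  · rfl
  obtain ⟨c, hc, hc'⟩ := exists_deriv_eq_slope ψ hlx
    (h.contDiffOn.continuousOn.mono (Icc_subset_Icc_right hx.2))
    fun y hy => (h.differentiableAt ⟨hy.1, hy.2.trans_le hx.2⟩).differentiableWithinAt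
  rw [hψ' c ⟨hc.1, hc.2.trans_le hx.2⟩, eq_comm, div_eq_zero_iff] at hc'
  rcases hc' with hc' | hc' <;> linarith

end Eigenpair

section Eigensystem

variable {l r : ℝ} {a : ℝ → ℝ} {ev : ℕ+ → ℝ} {φ : ℕ+ → ℝ → ℝ}

theorem IsDirichletEigensystem.continuousOn (hφ : IsDirichletEigensystem l r a ev φ) (k : ℕ+) :
    ContinuousOn (φ k) (Icc l r) :=
  (hφ.eigenpair k).contDiffOn.continuousOn

theorem memLp_two_of_continuousOn {f : ℝ → ℝ} (hf : ContinuousOn f (Icc l r)) :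
    MemLp f 2 (volume.restrict (Ioo l r)) :=
  (memLp_two_iff_integrable_sq
    ((hf.mono Ioo_subset_Icc_self).aestronglyMeasurable measurableSet_Ioo)).2
    ((hf.pow 2).integrableOn_Icc.mono_set Ioo_subset_Icc_self)

theorem IsDirichletEigensystem.integrable_mul (hφ : IsDirichletEigensystem l r a ev φ)
    (j k : ℕ+) : Integrable (fun x => φ j x * φ k x) (volume.restrict (Ioo l r)) :=
  (((hφ.continuousOn j).mul (hφ.continuousOn k)).integrableOn_Icc).mono_set Ioo_subset_Icc_self

theorem IsDirichletEigensystem.continuousOn_sum (hφ : IsDirichletEigensystem l r a ev φ)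
    (F : Finset ℕ+) (b : ℕ+ → ℝ) : ContinuousOn (fun x => ∑ k ∈ F, b k * φ k x) (Icc l r) :=
  continuousOn_finsetSum _ fun k _ => continuousOn_const.mul (hφ.continuousOn k)

theorem IsDirichletEigensystem.coeff_sum (hφ : IsDirichletEigensystem l r a ev φ)
    (F : Finset ℕ+) (b : ℕ+ → ℝ) (j : ℕ+) :
    coeff l r φ (fun x => ∑ k ∈ F, b k * φ k x) j = if j ∈ F then b j else 0 := by
  simp only [coeff, Finset.sum_mul, mul_assoc]
  rw [integral_finsetSum _ fun k _ => (hφ.integrable_mul k j).const_mul (b k)]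
  simp [integral_const_mul, hφ.orthonormal]

/-- Parseval's identity for finite linear combinations of the eigenfunctions. -/
theorem IsDirichletEigensystem.eLpNorm_sum (hφ : IsDirichletEigensystem l r a ev φ)
    (F : Finset ℕ+) (b : ℕ+ → ℝ) :
    eLpNorm (fun x => ∑ k ∈ F, b k * φ k x) 2 (volume.restrict (Ioo l r)) =
      ENNReal.ofReal (√(∑ k ∈ F, b k ^ 2)) := by
  rw [(memLp_two_of_continuousOn (hφ.continuousOn_sum F b)).eLpNorm_eq_integral_rpow_norm
    (by norm_num) (by norm_num), Real.sqrt_eq_rpow]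
  have hint : ∫ x in Ioo l r, (∑ k ∈ F, b k * φ k x) ^ 2 = ∑ k ∈ F, b k ^ 2 := by
    have h1 : ∀ x, (∑ k ∈ F, b k * φ k x) ^ 2 =
        ∑ j ∈ F, b j * ((∑ k ∈ F, b k * φ k x) * φ j x) := by
      intro x
      rw [sq, Finset.mul_sum]
      exact Finset.sum_congr rfl fun j _ => by ring
    simp only [h1]
    rw [integral_finsetSum]
    · refine Finset.sum_congr rfl fun j hj => ?_
      rw [integral_const_mul]
      have := hφ.coeff_sum F b j
      rw [coeff, if_pos hj] at this
      rw [this, sq]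
    · intro j _
      exact ((((hφ.continuousOn_sum F b).mul (hφ.continuousOn j)).integrableOn_Icc).mono_set
        Ioo_subset_Icc_self).const_mul _
  congr 2
  · rw [← hint]
    simp
  · simp

theorem coeff_congr_ae {f g : ℝ → ℝ} (h : f =ᵐ[volume.restrict (Ioo l r)] g) (k : ℕ+) :
    coeff l r φ f k = coeff l r φ g k :=
  integral_congr_ae (by filter_upwards [h] with x hx; rw [hx])

theorem IsDirichletEigensystem.hasFiniteExpansion_truncate
    (hφ : IsDirichletEigensystem l r a ev φ) (N : ℕ+) (g : ℝ → ℝ) :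
    HasFiniteExpansion l r φ (truncate l r φ N g) := by
  refine ⟨N, Eventually.of_forall fun x => Finset.sum_congr rfl fun k hk => ?_⟩
  have := hφ.coeff_sum (Finset.Icc 1 N) (coeff l r φ g) k
  rw [if_pos hk] at this
  exact congrArg (· * φ k x) this.symm

theorem IsDirichletEigensystem.coeff_eq_zero_of_ae_eq_truncate
    (hφ : IsDirichletEigensystem l r a ev φ) {N : ℕ+} {f : ℝ → ℝ}
    (hf : f =ᵐ[volume.restrict (Ioo l r)] truncate l r φ N f) {k : ℕ+}
    (hk : k ∉ Finset.Icc 1 N) : coeff l r φ f k = 0 := by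
  have := hφ.coeff_sum (Finset.Icc 1 N) (coeff l r φ f) k
  rw [if_neg hk] at this
  rw [coeff_congr_ae hf]
  exact this

end Eigensystem

/-! ### Data with a finite expansion -/

section FiniteExpansion

variable {l r : ℝ} {a : ℝ → ℝ} {ev : ℕ+ → ℝ} {φ : ℕ+ → ℝ → ℝ}

/-- The `n`-th partial sum `∑_{k ≤ n} α_k(t) φ_k(x)` of the expansion. -/
noncomputable def partialSum (l r : ℝ) (ev : ℕ+ → ℝ) (φ : ℕ+ → ℝ → ℝ) (T : ℝ) (uT : ℝ → ℝ)
    (n : ℕ+) (t x : ℝ) : ℝ :=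
  ∑ k ∈ Finset.Icc 1 n, alpha l r ev φ T uT k t * φ k x

theorem partialSum_terminal (T : ℝ) (uT : ℝ → ℝ) (n : ℕ+) :
    partialSum l r ev φ T uT n T = truncate l r φ n uT := by
  funext x
  simp [partialSum, truncate, alpha]

theorem IsDirichletEigensystem.memLp_partialSum (hφ : IsDirichletEigensystem l r a ev φ) (T : ℝ)
    (uT : ℝ → ℝ) (n : ℕ+) (t : ℝ) :
    MemLp (partialSum l r ev φ T uT n t) 2 (volume.restrict (Ioo l r)) :=
  memLp_two_of_continuousOn (hφ.continuousOn_sum _ _)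

theorem IsDirichletEigensystem.isGivenByExpansion_partialSum
    (hφ : IsDirichletEigensystem l r a ev φ) (T : ℝ) {N : ℕ+} {uT : ℝ → ℝ}
    (hf : uT =ᵐ[volume.restrict (Ioo l r)] truncate l r φ N uT) :
    IsGivenByExpansion l r ev φ T uT (partialSum l r ev φ T uT N) where
  memLp t _ := hφ.memLp_partialSum T uT N t
  expansion t _ := by
    refine tendsto_const_nhds.congr' ?_
    filter_upwards [eventually_ge_atTop N] with M hM
    have h : ∀ x, partialSum l r ev φ T uT N t x =
        ∑ k ∈ Finset.Icc 1 M, alpha l r ev φ T uT k t * φ k x := fun x =>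
      Finset.sum_subset (Finset.Icc_subset_Icc_right hM) fun k _ hk => by
        rw [alpha, hφ.coeff_eq_zero_of_ae_eq_truncate hf hk, mul_zero, zero_mul]
    simp [h]
  terminal := by
    rw [partialSum_terminal]
    exact hf.symm

/-- A partial sum solves the equation classically, whatever the data it is formed from. -/
theorem IsDirichletEigensystem.hasDerivAt_partialSum (hφ : IsDirichletEigensystem l r a ev φ)
    (ha : ContDiffOn ℝ ∞ a (Icc l r)) (T : ℝ) (uT : ℝ → ℝ) (n : ℕ+) (t : ℝ) {x : ℝ}
    (hx : x ∈ Ioo l r) :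
    HasDerivAt (fun τ => partialSum l r ev φ T uT n τ x)
      (deriv (fun y => a y * deriv (partialSum l r ev φ T uT n t) y) x) t := by
  have hflux : (fun y => a y * deriv (partialSum l r ev φ T uT n t) y) =ᶠ[𝓝 x]
      fun y => ∑ k ∈ Finset.Icc 1 n, alpha l r ev φ T uT k t * (a y * deriv (φ k) y) := by
    filter_upwards [Ioo_mem_nhds hx.1 hx.2] with y hy
    have h1 : HasDerivAt (partialSum l r ev φ T uT n t)
        (∑ k ∈ Finset.Icc 1 n, alpha l r ev φ T uT k t * deriv (φ k) y) y :=
      HasDerivAt.fun_sum fun k _ =>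
        ((hφ.eigenpair k).differentiableAt hy).hasDerivAt.const_mul _
    rw [h1.deriv, Finset.mul_sum]
    exact Finset.sum_congr rfl fun k _ => by ring
  have hspace : HasDerivAt
      (fun y => ∑ k ∈ Finset.Icc 1 n, alpha l r ev φ T uT k t * (a y * deriv (φ k) y))
      (∑ k ∈ Finset.Icc 1 n, alpha l r ev φ T uT k t * (-(ev k * φ k x))) x :=
    HasDerivAt.fun_sum fun k _ => ((hφ.eigenpair k).hasDerivAt_flux ha hx).const_mul _
  rw [hflux.deriv_eq, hspace.deriv]
  refine HasDerivAt.fun_sum fun k _ => ?_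
  have h1 : HasDerivAt (fun τ => ev k * (T - τ)) (ev k * (-1)) t :=
    ((hasDerivAt_id t).const_sub T).const_mul _
  refine ((h1.exp.mul_const (coeff l r φ uT k)).mul_const (φ k x)).congr_deriv ?_
  rw [alpha]
  ring

theorem IsDirichletEigensystem.isClassicalSolution_partialSum
    (hφ : IsDirichletEigensystem l r a ev φ) (ha : ContDiffOn ℝ ∞ a (Icc l r)) (T : ℝ) {N : ℕ+}
    {uT : ℝ → ℝ} (hf : uT =ᵐ[volume.restrict (Ioo l r)] truncate l r φ N uT) :
    IsClassicalSolution l r a T uT (partialSum l r ev φ T uT N) where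
  continuousOn := by
    refine continuousOn_finsetSum _ fun k _ => ContinuousOn.mul ?_ ?_
    · unfold alpha
      fun_prop
    · exact (hφ.continuousOn k).comp continuousOn_snd fun z hz => hz.2
  contDiffOn t _ := ContDiffOn.sum fun k _ => contDiffOn_const.mul (hφ.eigenpair k).contDiffOn
  pde t _ x hx := hφ.hasDerivAt_partialSum ha T uT N t hx
  left t _ := by simp [partialSum, (hφ.eigenpair _).left]
  right t _ := by simp [partialSum, (hφ.eigenpair _).right]
  terminal := by
    rw [partialSum_terminal]
    exact hf.symm

theorem IsDirichletEigensystem.memHs_partialSum (hφ : IsDirichletEigensystem l r a ev φ)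
    (T s : ℝ) (uT : ℝ → ℝ) (n : ℕ+) (t : ℝ) :
    MemHs l r ev φ s (partialSum l r ev φ T uT n t) := by
  refine ⟨hφ.memLp_partialSum T uT n t, ?_⟩
  refine summable_of_ne_finset_zero (s := Finset.Icc 1 n) fun k hk => ?_
  have := hφ.coeff_sum (Finset.Icc 1 n) (fun k => alpha l r ev φ T uT k t) k
  rw [if_neg hk] at this
  have h0 : coeff l r φ (partialSum l r ev φ T uT n t) k = 0 := this
  simp [h0]

end FiniteExpansion

/-! ### Recovery and the error estimate -/

section Recovery

variable {l r : ℝ} {a : ℝ → ℝ} {ev : ℕ+ → ℝ} {φ : ℕ+ → ℝ → ℝ}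

theorem recoverPoint_eq_partialSum (T : ℝ) (uT : ℝ → ℝ) {n : ℕ+} {p t : ℝ}
    (h : ∀ k ≤ n, ev k * (T - t) ≤ p) :
    recoverPoint l r ev φ T uT n p t = partialSum l r ev φ T uT n t := by
  funext x
  rw [recoverPoint, wTrunc, Finset.mul_sum]
  refine Finset.sum_congr rfl fun k hk => ?_
  rw [abs_of_nonneg (sub_nonneg.2 (h k (Finset.mem_Icc.1 hk).2)), alpha, ← mul_assoc, ← mul_assoc,
    ← Real.exp_add]
  congr 3
  ring

theorem recoverIntegral_eq_partialSum (T : ℝ) (uT : ℝ → ℝ) {n : ℕ+} {p t : ℝ}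
    (h : ∀ k ≤ n, ev k * (T - t) ≤ p) :
    recoverIntegral l r ev φ T uT n p t = partialSum l r ev φ T uT n t := by
  funext x
  have hw : ∀ q ∈ Ioi p, wTrunc l r ev φ T uT n t x q =
      Real.exp (-q) * partialSum l r ev φ T uT n t x := by
    intro q hq
    rw [← recoverPoint_eq_partialSum T uT fun k hk => (h k hk).trans (le_of_lt hq), recoverPoint,
      ← mul_assoc, ← Real.exp_add]
    simp
  rw [recoverIntegral, setIntegral_congr_fun measurableSet_Ioi hw, integral_mul_const,
    integral_exp_neg_Ioi, ← mul_assoc, ← Real.exp_add]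
  simp

/-- The tail of the expansion beyond the `n`-th term, measured at time `t`, is controlled by the
weighted tail `δ(n)` at time `0`. -/
theorem IsDirichletEigensystem.eLpNorm_partialSum_sub_le
    (hφ : IsDirichletEigensystem l r a ev φ) (hpos : ∀ k, 0 < ev k) {T s t : ℝ} (hs : 0 ≤ s)
    (ht : 0 ≤ t) (uT : ℝ → ℝ) {n N : ℕ+} (hnN : n ≤ N) :
    eLpNorm (fun x => partialSum l r ev φ T uT N t x - partialSum l r ev φ T uT n t x) 2
        (volume.restrict (Ioo l r)) ≤
      ENNReal.ofReal (Real.exp (-(ev n * t))) * delta l r ev φ T uT s n /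
        ENNReal.ofReal (ev n ^ (s / 2)) := by
  set F := Finset.Icc 1 N \ Finset.Icc 1 n with hF
  have hmem : ∀ k ∈ F, n ≤ k := by
    intro k hk
    simp only [hF, Finset.mem_sdiff, Finset.mem_Icc, one_le, true_and, not_le] at hk
    exact hk.2.le
  have hdiff : (fun x => partialSum l r ev φ T uT N t x - partialSum l r ev φ T uT n t x) =
      fun x => ∑ k ∈ F, alpha l r ev φ T uT k t * φ k x := by
    funext x
    rw [sub_eq_iff_eq_add]
    exact (Finset.sum_sdiff (Finset.Icc_subset_Icc_right hnN)).symm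
  set D := ∑ k ∈ F, alpha l r ev φ T uT k 0 ^ 2 * ev k ^ s with hD
  have hterm : ∀ k, 0 ≤ alpha l r ev φ T uT k 0 ^ 2 * ev k ^ s := fun k =>
    mul_nonneg (sq_nonneg _) (Real.rpow_nonneg (hpos k).le _)
  have hD0 : 0 ≤ D := Finset.sum_nonneg fun k _ => hterm k
  have hm : 0 < ev n ^ (s / 2) := Real.rpow_pos_of_pos (hpos n) _
  have hm2 : (ev n ^ (s / 2)) ^ 2 = ev n ^ s := by
    rw [← Real.rpow_natCast, ← Real.rpow_mul (hpos n).le]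
    congr 1
    push_cast
    ring
  have hsum : ∑ k ∈ F, alpha l r ev φ T uT k t ^ 2 ≤
      (Real.exp (-(ev n * t)) / ev n ^ (s / 2)) ^ 2 * D := by
    rw [hD, Finset.mul_sum]
    refine Finset.sum_le_sum fun k hk => ?_
    have hle : ev n ≤ ev k := hφ.monotone (hmem k hk)
    have hα : alpha l r ev φ T uT k t = Real.exp (-(ev k * t)) * alpha l r ev φ T uT k 0 := by
      rw [alpha, alpha, ← mul_assoc, ← Real.exp_add]
      congr 2
      ring
    have h1 : Real.exp (-(ev k * t)) ^ 2 ≤ Real.exp (-(ev n * t)) ^ 2 := by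
      gcongr
    have h2 : 1 ≤ ev k ^ s / ev n ^ s :=
      (one_le_div (Real.rpow_pos_of_pos (hpos n) s)).2 (Real.rpow_le_rpow (hpos n).le hle hs)
    calc alpha l r ev φ T uT k t ^ 2
        = Real.exp (-(ev k * t)) ^ 2 * 1 * alpha l r ev φ T uT k 0 ^ 2 := by rw [hα]; ring
      _ ≤ Real.exp (-(ev n * t)) ^ 2 * (ev k ^ s / ev n ^ s) * alpha l r ev φ T uT k 0 ^ 2 := by
          gcongr
      _ = _ := by rw [div_pow, hm2]; ring
  have hdelta : ENNReal.ofReal (√D) ≤ delta l r ev φ T uT s n := by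
    rw [Real.sqrt_eq_rpow, ← ENNReal.ofReal_rpow_of_nonneg hD0 (by norm_num), delta]
    refine ENNReal.rpow_le_rpow ?_ (by norm_num)
    rw [hD, ENNReal.ofReal_sum_of_nonneg fun k _ => hterm k]
    rw [tsum_subtype (Set.Ici n)
      (fun k => ENNReal.ofReal (|alpha l r ev φ T uT k 0| ^ 2 * ev k ^ s))]
    refine le_trans (Finset.sum_le_sum fun k hk => ?_) (ENNReal.sum_le_tsum F)
    rw [Set.indicator_of_mem (Set.mem_Ici.2 (hmem k hk)), sq_abs]
  rw [hdiff, hφ.eLpNorm_sum]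
  calc ENNReal.ofReal (√(∑ k ∈ F, alpha l r ev φ T uT k t ^ 2))
      ≤ ENNReal.ofReal (Real.exp (-(ev n * t)) / ev n ^ (s / 2) * √D) := by
        refine ENNReal.ofReal_le_ofReal ((Real.sqrt_le_sqrt hsum).trans_eq ?_)
        rw [Real.sqrt_mul (sq_nonneg _), Real.sqrt_sq (by positivity)]
    _ = ENNReal.ofReal (Real.exp (-(ev n * t))) * ENNReal.ofReal (√D) /
          ENNReal.ofReal (ev n ^ (s / 2)) := by
        rw [ENNReal.ofReal_mul (by positivity), ENNReal.ofReal_div_of_pos hm,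
          ENNReal.mul_div_right_comm]
    _ ≤ _ := by gcongr

theorem IsDirichletEigensystem.eLpNorm_sub_partialSum_le
    (hφ : IsDirichletEigensystem l r a ev φ) (hpos : ∀ k, 0 < ev k) {T s t : ℝ} (hs : 0 ≤ s)
    (ht : t ∈ Icc 0 T) {uT : ℝ → ℝ} {u : ℝ → ℝ → ℝ} (hu : IsGivenByExpansion l r ev φ T uT u)
    (n : ℕ+) :
    eLpNorm (fun x => u t x - partialSum l r ev φ T uT n t x) 2 (volume.restrict (Ioo l r)) ≤
      ENNReal.ofReal (Real.exp (-(ev n * t))) * delta l r ev φ T uT s n /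
        ENNReal.ofReal (ev n ^ (s / 2)) := by
  have hlim := (hu.expansion t ht).add_const
    (ENNReal.ofReal (Real.exp (-(ev n * t))) * delta l r ev φ T uT s n /
      ENNReal.ofReal (ev n ^ (s / 2)))
  rw [zero_add] at hlim
  refine ge_of_tendsto hlim ?_
  filter_upwards [eventually_ge_atTop n] with N hN
  have hS := hφ.memLp_partialSum T uT
  have hsplit : (fun x => u t x - partialSum l r ev φ T uT n t x) =
      (fun x => u t x - partialSum l r ev φ T uT N t x) +
        fun x => partialSum l r ev φ T uT N t x - partialSum l r ev φ T uT n t x := by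
    funext x
    simp
  rw [hsplit]
  refine (eLpNorm_add_le ((hu.memLp t ht).sub (hS N t)).aestronglyMeasurable
    ((hS N t).sub (hS n t)).aestronglyMeasurable (by norm_num)).trans ?_
  exact add_le_add le_rfl (hφ.eLpNorm_partialSum_sub_le hpos hs ht.1 uT hN)

end Recovery

end BackwardHeat

theorem mainTheorem3 (l r : ℝ) (hlr : l < r) (a : ℝ → ℝ) (α₀ : ℝ) (hα₀ : 0 < α₀)
    (ha : ContDiffOn ℝ ∞ a (Icc l r)) (haα : ∀ x ∈ Icc l r, α₀ ≤ a x)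
    (ev : ℕ+ → ℝ) (φ : ℕ+ → ℝ → ℝ) (hφ : BackwardHeat.IsDirichletEigensystem l r a ev φ)
    (T : ℝ) (hT : 0 < T) (s : ℝ) (hs : 0 ≤ s) :
    -- Data in `H^s` with a finite expansion, or truncated to have one: the expansion defines a
    -- solution of the backward problem, which stays in `H^s`.
    (∀ uT : ℝ → ℝ,
      ((BackwardHeat.MemHs l r ev φ s uT ∧ BackwardHeat.HasFiniteExpansion l r φ uT) ∨
        ∃ g : ℝ → ℝ, BackwardHeat.MemHs l r ev φ s g ∧
          ∃ N : ℕ+, uT = BackwardHeat.truncate l r φ N g) →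
      ∃ u : ℝ → ℝ → ℝ,
        BackwardHeat.IsGivenByExpansion l r ev φ T uT u ∧
        BackwardHeat.IsClassicalSolution l r a T uT u ∧
        ∀ t ∈ Icc 0 T, BackwardHeat.MemHs l r ev φ s (u t)) ∧
    -- The error estimate, whenever the solution is given by the expansion.
    (∀ (uT : ℝ → ℝ) (u : ℝ → ℝ → ℝ), BackwardHeat.MemHs l r ev φ s uT →
      BackwardHeat.IsGivenByExpansion l r ev φ T uT u →
      ∀ (ε : ℝ) (n : ℕ+), 0 < ε →
        BackwardHeat.delta l r ev φ T uT s n / ENNReal.ofReal (ev n ^ (s / 2))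
          ≤ ENNReal.ofReal ε →
        ∀ p : ℝ, ev n * T < p → ∀ un : ℝ → ℝ → ℝ,
          (un = BackwardHeat.recoverPoint l r ev φ T uT n p ∨
            un = BackwardHeat.recoverIntegral l r ev φ T uT n p) →
          ∀ t ∈ Icc 0 T,
            eLpNorm (fun x => u t x - un t x) 2 (volume.restrict (Ioo l r))
              ≤ ENNReal.ofReal (Real.exp (-(ev n * t))) *
                  BackwardHeat.delta l r ev φ T uT s n / ENNReal.ofReal (ev n ^ (s / 2)) ∧
            ENNReal.ofReal (Real.exp (-(ev n * t))) *
                BackwardHeat.delta l r ev φ T uT s n / ENNReal.ofReal (ev n ^ (s / 2))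
              ≤ ENNReal.ofReal ε) := by
  have hpos : ∀ k, 0 < ev k := fun k => (hφ.eigenpair k).eigenvalue_pos hlr hα₀ ha haα
  refine ⟨fun uT huT => ?_, fun uT u _ hu ε n _ hδ p hp un hun t ht => ⟨?_, ?_⟩⟩
  · have hfin : BackwardHeat.HasFiniteExpansion l r φ uT := by
      rcases huT with h | ⟨g, -, N, rfl⟩
      · exact h.2
      · exact hφ.hasFiniteExpansion_truncate N g
    obtain ⟨N, hN⟩ := hfin
    exact ⟨BackwardHeat.partialSum l r ev φ T uT N, hφ.isGivenByExpansion_partialSum T hN,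
      hφ.isClassicalSolution_partialSum ha T hN, fun t _ => hφ.memHs_partialSum T s uT N t⟩
  · have hk : ∀ k ≤ n, ev k * (T - t) ≤ p := fun k hkn =>
      calc ev k * (T - t) ≤ ev n * T :=
            mul_le_mul (hφ.monotone hkn) (by linarith [ht.1]) (by linarith [ht.2]) (hpos n).le
        _ ≤ p := hp.le
    have hut : un t = BackwardHeat.partialSum l r ev φ T uT n t := by
      rcases hun with rfl | rfl
      · exact BackwardHeat.recoverPoint_eq_partialSum T uT hk
      · exact BackwardHeat.recoverIntegral_eq_partialSum T uT hk
    rw [hut]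
    exact hφ.eLpNorm_sub_partialSum_le hpos hs ht hu n
  · refine le_trans ?_ hδ
    gcongr
    refine mul_le_of_le_one_left' (ENNReal.ofReal_le_one.2 ?_)
    exact Real.exp_le_one_iff.2 (neg_nonpos.2 (mul_nonneg (hpos n).le ht.1))
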